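/- Let $\mathbb{T}^2=\mathbb{R}^2/\mathbb{Z}^2$ with normalized Lebesgue measure $\mu$, let $T(x,y)=(2x+y,\,x+y)$ be Arnold's cat map on $\mathbb{T}^2$, and let $\vec u=\bigl(\tfrac{1+\sqrt5}{2},1\bigr)$ be its unstable eigenvector. Let $v:\mathbb{T}^2\to\mathbb{R}$ be a bounded measurable potential which, regarded as a function on the fundamental domain $[0,1)^2$, is $C^1$ (one-sided derivatives on the edges that belong to the square; no continuity across the boundary of the fundamental domain is required), and suppose that there is $c>0$ with $D_{\vec u}v(\omega)=\nabla v(\omega)\cdot\vec u>c$ for all $\omega\in[0,1)^2$. For $\lambda,E\in\mathbb{R}$ put $$A^{(E-\lambda v)}(\omega)=\begin{pmatrix}E-\lambda v(\omega)&-1\\1&0\end{pmatrix},\qquad A^{(E-\lambda v)}_n(\omega)=A^{(E-\lambda v)}(T^{n-1}\omega)\cdots A^{(E-\lambda v)}(\omega),$$ and let $$L(E;\lambda)=\lim_{n\to\infty}\frac1n\int_{\mathbb{T}^2}\log\bigl\|A^{(E-\lambda v)}_n(\omega)\bigr\|\,d\mu(\omega)$$ be the Lyapunov exponent of the Schrödinger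 cocycle $(T,A^{(E-\lambda v)})$, where $\|\cdot\|$ is the operator norm for the Euclidean norm on $\mathbb{R}^2$; the integrals and the limit exist. Then there is a constant $C_0=C_0(v)>0$ such that for every $\lambda>0$ $$L(E;\lambda)>\log\lambda-C_0\qquad\text{for all }E\in\mathbb{R}.$$ In particular, there is $\lambda_0=\lambda_0(v)>0$ such that for every $\lambda\ge\lambda_0$ the Lyapunov exponent $L(E;\lambda)$ is bounded below by a positive constant uniformly in $E\in\mathbb{R}$. -/

import Mathlib

open MeasureTheory Filter Topology

/-- The two-dimensional torus `ℝ² / ℤ²`, with its Borel σ-algebra and the product `volume` of the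
two Lebesgue (probability) measures on `ℝ / ℤ`. -/
abbrev Torus2 : Type := UnitAddCircle × UnitAddCircle

/-- The quotient map `ℝ² → ℝ² / ℤ²`. -/
def toTorus2 (p : ℝ × ℝ) : Torus2 := ((p.1 : UnitAddCircle), (p.2 : UnitAddCircle))

/-- Arnold's cat map `(x, y) ↦ (2x + y, x + y)` on the torus. -/
def catMap (ω : Torus2) : Torus2 := (2 • ω.1 + ω.2, ω.1 + ω.2)

/-- The unstable eigenvector of the cat map, with eigenvalue `(3 + √5) / 2`. -/
noncomputable def unstableVec : ℝ × ℝ := ((1 + √5) / 2, 1)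

/-- The half-open unit square `[0,1)²`, a fundamental domain of the torus. -/
def unitSquare : Set (ℝ × ℝ) := Set.Ico (0 : ℝ) 1 ×ˢ Set.Ico (0 : ℝ) 1

/-- The Schrödinger cocycle map `ω ↦ !![E - lam * v ω, -1; 1, 0]`. -/
noncomputable def schrodingerMatrix (v : Torus2 → ℝ) (lam E : ℝ) (ω : Torus2) :
    Matrix (Fin 2) (Fin 2) ℝ :=
  !![E - lam * v ω, -1; 1, 0]

/-- The `n`-step transfer matrix `A (Tⁿ⁻¹ ω) ⋯ A (T ω) * A ω` over the cat map `T`. -/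
noncomputable def transferMatrix (v : Torus2 → ℝ) (lam E : ℝ) :
    ℕ → Torus2 → Matrix (Fin 2) (Fin 2) ℝ
  | 0, _ => 1
  | n + 1, ω => schrodingerMatrix v lam E (catMap^[n] ω) * transferMatrix v lam E n ω

/-- `log ‖Aₙ(ω)‖`, with the operator norm induced by the Euclidean norm of `ℝ²`. -/
noncomputable def logNormTransfer (v : Torus2 → ℝ) (lam E : ℝ) (n : ℕ) (ω : Torus2) : ℝ :=
  Real.log ‖Matrix.toEuclideanCLM (n := Fin 2) (𝕜 := ℝ) (transferMatrix v lam E n ω)‖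

/-- The average `(1 / n) ∫ log ‖Aₙ(ω)‖ dμ(ω)`. -/
noncomputable def meanLogNorm (v : Torus2 → ℝ) (lam E : ℝ) (n : ℕ) : ℝ :=
  (1 / (n : ℝ)) * ∫ ω : Torus2, logNormTransfer v lam E n ω

/-- The Lyapunov exponent `L(E; lam) = lim (1 / n) ∫ log ‖Aₙ(ω)‖ dμ(ω)` of the Schrödinger
cocycle. -/
noncomputable def lyapunovExponent (v : Torus2 → ℝ) (E lam : ℝ) : ℝ :=
  limUnder atTop (meanLogNorm v lam E)

/-! The norm of `Aₙ` dominates its upper left entry, which is a product of the Riccati ratios `S₀ =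
E - λv`, `Sₙ₊₁ = E - λ v∘Tⁿ⁺¹ - 1/Sₙ`. So it suffices to bound the mean of `log |Sₙ|` below by `log
λ - C`, uniformly in `n` and `E`.

Restrict to a segment `ω + t u`, `0 ≤ t ≤ 1`, in the unstable direction, and let `μ` be the unstable
eigenvalue. While `Tⁿ` of the segment stays in one fundamental square, `v∘Tⁿ` increases at rate at
least `cμⁿ`. Where `Sₙ` decreases without changing sign, `-1/Sₙ` decreases too and can only help.
Hence `Sₙ` falls at rate at least `λcμⁿ` on each of finitely many pieces. Passing from `n` to `n +
1` at most doubles the pieces (sign of `Sₙ`) and adds `O(μⁿ)` cuts (walls crossed). Since `μ > 2`,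
there are only `O(μⁿ)` pieces, the powers of `μ` cancel, and `{|Sₙ| < ε}` has measure `O(ε/(cλ))`
(`exists_monotone_label`, `volume_abs_lt_le_of_recursion`). Fubini carries this to the torus
(`measure_le_of_forall_line`), and the layer-cake formula turns it into the bound on the logarithm
(`lintegral_neg_log_le`). -/

/-! ### Transfer matrices and existence of the Lyapunov exponent. -/

theorem transferMatrix_add (v : Torus2 → ℝ) (lam E : ℝ) (m n : ℕ) (ω : Torus2) :
    transferMatrix v lam E (m + n) ω =
      transferMatrix v lam E m (catMap^[n] ω) * transferMatrix v lam E n ω := by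
  induction m with
  | zero => simp [transferMatrix]
  | succ m ih =>
    rw [Nat.succ_add, transferMatrix, transferMatrix, ih, Function.iterate_add_apply, mul_assoc]

theorem det_transferMatrix (v : Torus2 → ℝ) (lam E : ℝ) (n : ℕ) (ω : Torus2) :
    (transferMatrix v lam E n ω).det = 1 := by
  induction n with
  | zero => simp [transferMatrix]
  | succ n ih => 
    rw [transferMatrix, Matrix.det_mul, ih, schrodingerMatrix, Matrix.det_fin_two_of]; simp

theorem sq_add_sq_le_opNorm_sq (A : Matrix (Fin 2) (Fin 2) ℝ) (j : Fin 2) :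
    A 0 j ^ 2 + A 1 j ^ 2 ≤ ‖Matrix.toEuclideanCLM (n := Fin 2) (𝕜 := ℝ) A‖ ^ 2 := by
  have h := (Matrix.toEuclideanCLM (n := Fin 2) (𝕜 := ℝ) A).le_opNorm (EuclideanSpace.single j 1)
  rw [PiLp.norm_single, norm_one, mul_one] at h
  have h2 := pow_le_pow_left₀ (norm_nonneg _) h 2
  rw [EuclideanSpace.norm_sq_eq, Fin.sum_univ_two] at h2
  fin_cases j <;> simpa [Matrix.mulVec_single_one] using h2

theorem abs_entry_le_opNorm (A : Matrix (Fin 2) (Fin 2) ℝ) :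
    |A 0 0| ≤ ‖Matrix.toEuclideanCLM (n := Fin 2) (𝕜 := ℝ) A‖ :=
  abs_le_of_sq_le_sq (by linarith [sq_add_sq_le_opNorm_sq A 0, sq_nonneg (A 1 0)])
    (norm_nonneg _)

/-- Twice the determinant is at most the sum of the squared entries, hence at most `2‖A‖²` by the
two column bounds. -/
theorem one_le_opNorm_of_det_eq_one (A : Matrix (Fin 2) (Fin 2) ℝ) (hA : A.det = 1) :
    1 ≤ ‖Matrix.toEuclideanCLM (n := Fin 2) (𝕜 := ℝ) A‖ := by
  have h0 := sq_add_sq_le_opNorm_sq A 0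
  have h1 := sq_add_sq_le_opNorm_sq A 1
  rw [Matrix.det_fin_two] at hA
  have := norm_nonneg (Matrix.toEuclideanCLM (n := Fin 2) (𝕜 := ℝ) A)
  nlinarith [sq_nonneg (A 0 0 - A 1 1), sq_nonneg (A 0 1 + A 1 0)]

theorem one_le_norm_transferMatrix (v : Torus2 → ℝ) (lam E : ℝ) (n : ℕ) (ω : Torus2) :
    1 ≤ ‖Matrix.toEuclideanCLM (n := Fin 2) (𝕜 := ℝ) (transferMatrix v lam E n ω)‖ :=
  one_le_opNorm_of_det_eq_one _ (det_transferMatrix v lam E n ω)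

theorem logNormTransfer_nonneg (v : Torus2 → ℝ) (lam E : ℝ) (n : ℕ) (ω : Torus2) :
    0 ≤ logNormTransfer v lam E n ω :=
  Real.log_nonneg (one_le_norm_transferMatrix v lam E n ω)

theorem logNormTransfer_add_le (v : Torus2 → ℝ) (lam E : ℝ) (m n : ℕ) (ω : Torus2) :
    logNormTransfer v lam E (m + n) ω ≤
      logNormTransfer v lam E m (catMap^[n] ω) + logNormTransfer v lam E n ω := by
  have pos : ∀ (k : ℕ) (η : Torus2),
      0 < ‖Matrix.toEuclideanCLM (n := Fin 2) (𝕜 := ℝ) (transferMatrix v lam E k η)‖ :=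
    fun k η => zero_lt_one.trans_le (one_le_norm_transferMatrix v lam E k η)
  rw [logNormTransfer, logNormTransfer, logNormTransfer,
    ← Real.log_mul (pos _ _).ne' (pos _ _).ne']
  refine Real.log_le_log (pos _ _) ?_
  rw [transferMatrix_add, map_mul]
  exact norm_mul_le _ _

theorem exists_logNormTransfer_le (v : Torus2 → ℝ) (hbdd : ∃ M : ℝ, ∀ ω : Torus2, |v ω| ≤ M)
    (lam E : ℝ) : ∃ K : ℝ, ∀ (n : ℕ) (ω : Torus2), logNormTransfer v lam E n ω ≤ n * K := by
  obtain ⟨M, hM⟩ := hbdd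
  let Φ := Matrix.toEuclideanCLM (n := Fin 2) (𝕜 := ℝ)
  let P : Matrix (Fin 2) (Fin 2) ℝ := !![1, 0; 0, 0]
  let J : Matrix (Fin 2) (Fin 2) ℝ := !![0, -1; 1, 0]
  have hone : ∀ ω, logNormTransfer v lam E 1 ω ≤
      Real.log ((|E| + |lam| * M) * ‖Φ P‖ + ‖Φ J‖) := by
    intro ω
    refine Real.log_le_log (zero_lt_one.trans_le (one_le_norm_transferMatrix v lam E 1 ω)) ?_
    have : transferMatrix v lam E 1 ω = (E - lam * v ω) • P + J := by
      ext i j; fin_cases i <;> fin_cases j <;> simp [transferMatrix, schrodingerMatrix, P, J]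
    rw [this, map_add, map_smul]
    refine (norm_add_le _ _).trans ?_
    rw [norm_smul]
    gcongr
    rw [Real.norm_eq_abs]
    refine (abs_sub _ _).trans ?_
    rw [abs_mul]
    gcongr
    exact hM ω
  refine ⟨Real.log ((|E| + |lam| * M) * ‖Φ P‖ + ‖Φ J‖), fun n => ?_⟩
  induction n with
  | zero => intro ω; simp [logNormTransfer, transferMatrix]
  | succ n ih =>
    intro ω
    have := logNormTransfer_add_le v lam E 1 n ω
    rw [add_comm 1 n] at this
    push_cast
    linarith [ih ω, hone (catMap^[n] ω)]

instance isProbabilityMeasure_unitAddCircle : IsProbabilityMeasure (volume : Measure UnitAddCircle) :=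
  ⟨UnitAddCircle.measure_univ⟩

instance isProbabilityMeasure_torus2 : IsProbabilityMeasure (volume : Measure Torus2) :=
  inferInstanceAs (IsProbabilityMeasure ((volume : Measure UnitAddCircle).prod volume))

instance isAddLeftInvariant_unitAddCircle : (volume : Measure UnitAddCircle).IsAddLeftInvariant :=
  inferInstanceAs ((volume : Measure (AddCircle (1 : ℝ))).IsAddLeftInvariant)

instance isAddLeftInvariant_torus2 : (volume : Measure Torus2).IsAddLeftInvariant :=
  inferInstanceAs (((volume : Measure UnitAddCircle).prod volume).IsAddLeftInvariant)

theorem measurePreserving_catMap : MeasurePreserving catMap volume volume := by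
  have h1 := measurePreserving_prod_add (volume : Measure UnitAddCircle) volume
  have h2 := measurePreserving_prod_add_swap (volume : Measure UnitAddCircle) volume
  have h3 := Measure.measurePreserving_swap (μ := (volume : Measure UnitAddCircle))
    (ν := (volume : Measure UnitAddCircle))
  -- The cat map factors through measure-preserving maps: a shear, a shear with swap, and a swap.
  have h : catMap = Prod.swap ∘ (fun z : UnitAddCircle × UnitAddCircle => (z.2, z.2 + z.1)) ∘
      fun z : UnitAddCircle × UnitAddCircle => (z.1, z.1 + z.2) := by
    funext ω
    refine Prod.ext ?_ rfl
    simp only [catMap, Function.comp, Prod.swap]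
    abel
  rw [h]
  exact h3.comp (h2.comp h1)

theorem measurable_transferMatrix_apply (v : Torus2 → ℝ) (hv : Measurable v) (lam E : ℝ) (n : ℕ)
    (i j : Fin 2) : Measurable fun ω => transferMatrix v lam E n ω i j := by
  induction n generalizing i with
  | zero => exact measurable_const
  | succ n ih =>
    simp only [transferMatrix, Matrix.mul_apply, Fin.sum_univ_two]
    have hS : ∀ k l, Measurable fun ω => schrodingerMatrix v lam E (catMap^[n] ω) k l := by
      have hT : Measurable fun ω => v (catMap^[n] ω) :=
        hv.comp (measurePreserving_catMap.measurable.iterate n)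
      intro k l
      fin_cases k <;> fin_cases l <;> simp [schrodingerMatrix]
      exact measurable_const.sub (measurable_const.mul hT)
    exact ((hS i 0).mul (ih 0)).add ((hS i 1).mul (ih 1))

theorem measurable_logNormTransfer (v : Torus2 → ℝ) (hv : Measurable v) (lam E : ℝ) (n : ℕ) :
    Measurable (logNormTransfer v lam E n) := by
  refine Real.measurable_log.comp ?_
  have hc : Continuous fun B : Fin 2 → Fin 2 → ℝ =>
      ‖Matrix.toEuclideanCLM (n := Fin 2) (𝕜 := ℝ) (Matrix.of B)‖ := by
    refine continuous_norm.comp ?_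
    exact LinearMap.continuous_of_finiteDimensional
      ((Matrix.toEuclideanCLM (n := Fin 2) (𝕜 := ℝ)).toAlgEquiv.toLinearMap :
        Matrix (Fin 2) (Fin 2) ℝ →ₗ[ℝ] _)
  exact hc.measurable.comp (measurable_pi_iff.2 fun i => measurable_pi_iff.2 fun j =>
    measurable_transferMatrix_apply v hv lam E n i j)

theorem integrable_logNormTransfer (v : Torus2 → ℝ) (hv : Measurable v)
    (hbdd : ∃ M : ℝ, ∀ ω : Torus2, |v ω| ≤ M) (lam E : ℝ) (n : ℕ) :
    Integrable (logNormTransfer v lam E n) := by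
  obtain ⟨K, hK⟩ := exists_logNormTransfer_le v hbdd lam E
  refine Integrable.of_bound (measurable_logNormTransfer v hv lam E n).aestronglyMeasurable (n * K)
    (ae_of_all _ fun ω => ?_)
  rw [Real.norm_eq_abs, abs_of_nonneg (logNormTransfer_nonneg v lam E n ω)]
  exact hK n ω

/-- Fekete's lemma: the integrals are subadditive because `T` preserves the measure, and they are
nonnegative. -/
theorem tendsto_meanLogNorm (v : Torus2 → ℝ) (hv : Measurable v)
    (hbdd : ∃ M : ℝ, ∀ ω : Torus2, |v ω| ≤ M) (lam E : ℝ) :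
    Tendsto (meanLogNorm v lam E) atTop (𝓝 (lyapunovExponent v E lam)) := by
  have hint := integrable_logNormTransfer v hv hbdd lam E
  have hsub : Subadditive fun n => ∫ ω, logNormTransfer v lam E n ω := by
    intro m n
    dsimp only
    have hT := measurePreserving_catMap.iterate n
    have hcomp : Integrable fun ω => logNormTransfer v lam E m (catMap^[n] ω) :=
      hT.integrable_comp_of_integrable (hint m)
    have heq : ∫ ω, logNormTransfer v lam E m (catMap^[n] ω) =
        ∫ ω, logNormTransfer v lam E m ω := by
      conv_rhs => rw [← hT.map_eq]
      rw [integral_map hT.measurable.aemeasurable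
        (measurable_logNormTransfer v hv lam E m).aestronglyMeasurable]
    rw [← heq, ← integral_add hcomp (hint n)]
    exact integral_mono (hint _) (hcomp.add (hint n)) (logNormTransfer_add_le v lam E m n)
  have hlim := hsub.tendsto_lim ⟨0, by
    rintro _ ⟨n, rfl⟩
    exact div_nonneg (integral_nonneg (logNormTransfer_nonneg v lam E n)) n.cast_nonneg⟩
  have : Tendsto (meanLogNorm v lam E) atTop (𝓝 hsub.lim) := by
    refine hlim.congr fun n => ?_
    rw [meanLogNorm]; ring
  rwa [lyapunovExponent, this.limUnder_eq]

/-! ### Unstable lines and growth of the potential along them. -/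

/-- The unstable eigenvalue of the cat map. -/
noncomputable def catEigenvalue : ℝ := (3 + √5) / 2

theorem catEigenvalue_sq : catEigenvalue ^ 2 = 3 * catEigenvalue - 1 := by
  have := Real.sq_sqrt (show (0 : ℝ) ≤ 5 by norm_num)
  rw [catEigenvalue]; linarith

theorem lt_catEigenvalue : 5 / 2 < catEigenvalue := by
  have : (2 : ℝ) < √5 := Real.lt_sqrt_of_sq_lt (by norm_num)
  rw [catEigenvalue]; linarith

theorem catEigenvalue_lt : catEigenvalue < 3 := by
  nlinarith [catEigenvalue_sq, lt_catEigenvalue]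

theorem catEigenvalue_pos : 0 < catEigenvalue := by linarith [lt_catEigenvalue]

theorem one_le_catEigenvalue_pow (n : ℕ) : 1 ≤ catEigenvalue ^ n :=
  one_le_pow₀ (by linarith [lt_catEigenvalue])

theorem unstableVec_fst : unstableVec.1 = catEigenvalue - 1 := by
  rw [unstableVec, catEigenvalue]; ring

theorem unstableVec_snd : unstableVec.2 = 1 := rfl

theorem catMap_toTorus2 (p : ℝ × ℝ) :
    catMap (toTorus2 p) = toTorus2 (2 * p.1 + p.2, p.1 + p.2) := by
  rw [two_mul, catMap, two_nsmul]
  rfl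

theorem exists_iterate_catMap_line (n : ℕ) (p : ℝ × ℝ) : ∃ q : ℝ × ℝ, ∀ t : ℝ,
    catMap^[n] (toTorus2 (p + t • unstableVec)) =
      toTorus2 (q + (catEigenvalue ^ n * t) • unstableVec) := by
  induction n with
  | zero => exact ⟨p, fun t => by simp⟩
  | succ n ih =>
    obtain ⟨q, hq⟩ := ih
    refine ⟨(2 * q.1 + q.2, q.1 + q.2), fun t => ?_⟩
    rw [Function.iterate_succ_apply', hq, catMap_toTorus2]
    congr 1
    have h := catEigenvalue_sq
    refine Prod.ext ?_ ?_
    · simp only [Prod.fst_add, Prod.snd_add, Prod.smul_fst, Prod.smul_snd, smul_eq_mul,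
        unstableVec_fst, unstableVec_snd, pow_succ]
      linear_combination -(catEigenvalue ^ n * t) * h
    · simp only [Prod.fst_add, Prod.snd_add, Prod.smul_fst, Prod.smul_snd, smul_eq_mul,
        unstableVec_fst, unstableVec_snd, pow_succ]
      ring

theorem toTorus2_sub_int (p : ℝ × ℝ) (a b : ℤ) : toTorus2 (p - ((a : ℝ), (b : ℝ))) = toTorus2 p := by
  have key : ∀ (x : ℝ) (m : ℤ), ((x - m : ℝ) : UnitAddCircle) = x := fun x m => by
    rw [AddCircle.coe_sub, sub_eq_self, AddCircle.coe_eq_zero_iff]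
    exact ⟨m, by simp⟩
  exact Prod.ext (key _ _) (key _ _)

theorem convex_unitSquare : Convex ℝ unitSquare := (convex_Ico 0 1).prod (convex_Ico 0 1)

theorem mul_le_sub_of_mem_unitSquare {f : ℝ × ℝ → ℝ} {c : ℝ}
    (hC1 : DifferentiableOn ℝ f unitSquare)
    (hmono : ∀ p ∈ unitSquare, c < fderivWithin ℝ f unitSquare p unstableVec)
    {p : ℝ × ℝ} {s : ℝ} (hs : 0 ≤ s) (hp : p ∈ unitSquare) (hps : p + s • unstableVec ∈ unitSquare) :
    c * s ≤ f (p + s • unstableVec) - f p := by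
  have hseg : ∀ t ∈ Set.Icc 0 s, p + t • unstableVec ∈ unitSquare := by
    intro t ht
    rcases hs.eq_or_lt with rfl | hs'
    · rw [le_antisymm ht.2 ht.1]; exact hps
    have := convex_unitSquare.add_smul_mem hp hps
      (t := t / s) ⟨div_nonneg ht.1 hs, div_le_one_of_le₀ ht.2 hs⟩
    rwa [smul_smul, div_mul_cancel₀ _ hs'.ne'] at this
  have hder : ∀ t ∈ Set.Icc 0 s, HasDerivWithinAt (fun t : ℝ => f (p + t • unstableVec))
      (fderivWithin ℝ f unitSquare (p + t • unstableVec) unstableVec) (Set.Icc 0 s) t := by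
    intro t ht
    have hline : HasDerivWithinAt (fun t : ℝ => p + t • unstableVec) unstableVec (Set.Icc 0 s) t := by
      simpa using ((hasDerivWithinAt_id t (Set.Icc 0 s)).smul_const unstableVec).const_add p
    exact ((hC1 _ (hseg t ht)).hasFDerivWithinAt).comp_hasDerivWithinAt t hline hseg
  have := (convex_Icc (0 : ℝ) s).mul_sub_le_image_sub_of_le_deriv
    (fun t ht => (hder t ht).continuousWithinAt)
    (fun t ht => ((hder t (interior_subset ht)).hasDerivAt
      (mem_interior_iff_mem_nhds.1 ht)).differentiableAt.differentiableWithinAt)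
    (C := c) (fun t ht => by
      rw [((hder t (interior_subset ht)).hasDerivAt (mem_interior_iff_mem_nhds.1 ht)).deriv]
      exact (hmono _ (hseg t (interior_subset ht))).le)
    0 (Set.left_mem_Icc.2 hs) s (Set.right_mem_Icc.2 hs) hs
  simpa using this

/-- Equal floors put both endpoints in the same integer translate of the fundamental square. -/
theorem mul_le_sub_of_floor_eq {v : Torus2 → ℝ} {c : ℝ}
    (hC1 : DifferentiableOn ℝ (fun p : ℝ × ℝ => v (toTorus2 p)) unitSquare)
    (hmono : ∀ p ∈ unitSquare,
      c < fderivWithin ℝ (fun q : ℝ × ℝ => v (toTorus2 q)) unitSquare p unstableVec)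
    {p : ℝ × ℝ} {s : ℝ} (hs : 0 ≤ s) (h1 : ⌊p.1⌋ = ⌊(p + s • unstableVec).1⌋)
    (h2 : ⌊p.2⌋ = ⌊(p + s • unstableVec).2⌋) :
    c * s ≤ v (toTorus2 (p + s • unstableVec)) - v (toTorus2 p) := by
  have mem : ∀ q : ℝ × ℝ, q - ((⌊q.1⌋ : ℝ), (⌊q.2⌋ : ℝ)) ∈ unitSquare := fun q =>
    ⟨⟨Int.fract_nonneg _, Int.fract_lt_one _⟩, ⟨Int.fract_nonneg _, Int.fract_lt_one _⟩⟩
  have hp := mem p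
  have hps := mem (p + s • unstableVec)
  rw [← h1, ← h2] at hps
  rw [add_sub_right_comm] at hps
  have := mul_le_sub_of_mem_unitSquare hC1 hmono hs hp hps
  rwa [← add_sub_right_comm, toTorus2_sub_int, toTorus2_sub_int] at this

/-! ### Counting the pieces on which the Riccati ratios decrease. -/

/-- The pieces are encoded as the fibres of a monotone integer label `κ`, so that counting them
amounts to bounding its range. Common refinement of partitions becomes addition of labels: a sum of
monotone functions repeats a value only if each summand does. -/
theorem exists_monotone_label {c lam E : ℝ} (hc : 0 < c) (hlam : 0 < lam)
    {V S : ℕ → ℝ → ℝ} {l : ℕ → ℝ → ℤ} (hl : ∀ n, Monotone (l n))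
    (hw : ∀ n, (l n 1 : ℝ) - l n 0 ≤ catEigenvalue ^ (n + 1) + 2)
    (hV : ∀ n t t', t ≤ t' → l n t = l n t' →
      c * catEigenvalue ^ n * (t' - t) ≤ V n t' - V n t)
    (hS0 : ∀ t, S 0 t = E - lam * V 0 t)
    (hS : ∀ n t, S (n + 1) t = E - lam * V (n + 1) t - (S n t)⁻¹) (n : ℕ) :
    ∃ (κ : ℝ → ℤ) (a W : ℤ), (W : ℝ) ≤ 20 * catEigenvalue ^ n ∧
      MonotoneOn κ {t ∈ Set.Icc (0 : ℝ) 1 | ∀ j < n, S j t ≠ 0} ∧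
      (∀ t ∈ {t ∈ Set.Icc (0 : ℝ) 1 | ∀ j < n, S j t ≠ 0}, κ t ∈ Finset.Icc a (a + W)) ∧
      ∀ t ∈ {t ∈ Set.Icc (0 : ℝ) 1 | ∀ j < n, S j t ≠ 0},
        ∀ t' ∈ {t ∈ Set.Icc (0 : ℝ) 1 | ∀ j < n, S j t ≠ 0}, t ≤ t' → κ t = κ t' →
          lam * c * catEigenvalue ^ n * (t' - t) ≤ S n t - S n t' := by
  have hrange : ∀ n, ∀ t ∈ Set.Icc (0 : ℝ) 1, l n 0 ≤ l n t ∧ l n t ≤ l n 1 :=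
    fun n t ht => ⟨hl n ht.1, hl n ht.2⟩
  have hμ := lt_catEigenvalue
  have hμ' := catEigenvalue_lt
  have hV' : ∀ n t t', t ≤ t' → l n t = l n t' →
      lam * c * catEigenvalue ^ n * (t' - t) ≤ lam * V n t' - lam * V n t := by
    intro n t t' ht h
    have := mul_le_mul_of_nonneg_left (hV n t t' ht h) hlam.le
    linarith
  induction n with
  | zero =>
    refine ⟨l 0, l 0 0, l 0 1 - l 0 0, ?_, (hl 0).monotoneOn _, fun t ht => ?_,
      fun t _ t' _ htt' h => ?_⟩
    · have := hw 0
      push_cast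
      simp only [zero_add, pow_one, pow_zero] at *
      linarith
    · have := hrange 0 t ht.1
      rw [Finset.mem_Icc]; omega
    · rw [hS0, hS0]
      linarith [hV' 0 t t' htt' h]
  | succ n ih =>
    obtain ⟨κ, a, W, hW, hmono, hmem, hrate⟩ := ih
    have hsub : ∀ t ∈ {t ∈ Set.Icc (0 : ℝ) 1 | ∀ j < n + 1, S j t ≠ 0},
        t ∈ {t ∈ Set.Icc (0 : ℝ) 1 | ∀ j < n, S j t ≠ 0} :=
      fun t ht => ⟨ht.1, fun j hj => ht.2 j (hj.trans n.lt_succ_self)⟩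
    have hk : 0 ≤ lam * c * catEigenvalue ^ n :=
      mul_nonneg (mul_pos hlam hc).le (pow_pos catEigenvalue_pos n).le
    -- Inside a fibre of `κ`, `S n` decreases, so the sign indicator can only go from 0 to 1;
    -- between fibres `2κ` jumps by at least 2, which absorbs a drop of the indicator.
    have hsplit : ∀ t ∈ {t ∈ Set.Icc (0 : ℝ) 1 | ∀ j < n + 1, S j t ≠ 0},
        ∀ t' ∈ {t ∈ Set.Icc (0 : ℝ) 1 | ∀ j < n + 1, S j t ≠ 0}, t ≤ t' →
          2 * κ t + (if S n t < 0 then 1 else 0) ≤ 2 * κ t' + (if S n t' < 0 then 1 else 0) := by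
      intro t ht t' ht' htt'
      rcases (hmono (hsub t ht) (hsub t' ht') htt').lt_or_eq with h | h
      · split_ifs <;> omega
      · have := hrate t (hsub t ht) t' (hsub t' ht') htt' h
        have h0 : 0 ≤ S n t - S n t' := (mul_nonneg hk (sub_nonneg.2 htt')).trans this
        split_ifs
        · omega
        · linarith
        · omega
        · omega
    refine ⟨fun t => 2 * κ t + (if S n t < 0 then 1 else 0) + l (n + 1) t,
      2 * a + l (n + 1) 0, 2 * W + 1 + (l (n + 1) 1 - l (n + 1) 0), ?_, ?_, ?_, ?_⟩
    -- The constant 20 closes the induction: `40 + 1 + (3μ - 1) + 2 ≤ 20μ` because `μ > 5/2`.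
    · have h1 := hw (n + 1)
      have h2 := one_le_catEigenvalue_pow n
      push_cast
      rw [show n + 1 + 1 = n + 2 from rfl, pow_add, catEigenvalue_sq] at h1
      rw [pow_succ]
      nlinarith
    · intro t ht t' ht' htt'
      exact add_le_add (hsplit t ht t' ht' htt') (hl _ htt')
    · intro t ht
      have h1 := hrange (n + 1) t ht.1
      have h2 := Finset.mem_Icc.1 (hmem t (hsub t ht))
      rw [Finset.mem_Icc]
      dsimp only
      split_ifs <;> omega
    · intro t ht t' ht' htt' heq
      have h1 := hsplit t ht t' ht' htt'
      have h2 := hl (n + 1) htt'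
      have hl_eq : l (n + 1) t = l (n + 1) t' := by
        dsimp only at heq; omega
      have hκ : κ t = κ t' := by
        dsimp only at heq; split_ifs at heq <;> omega
      have hsign : S n t < 0 ↔ S n t' < 0 := by
        dsimp only at heq
        split_ifs at heq with h3 h4 h4
        · exact iff_of_true h3 h4
        · omega
        · omega
        · exact iff_of_false h3 h4
      have h0 : 0 ≤ S n t - S n t' := (mul_nonneg hk (sub_nonneg.2 htt')).trans
        (hrate t (hsub t ht) t' (hsub t' ht') htt' hκ)
      have hinv : (S n t)⁻¹ ≤ (S n t')⁻¹ := by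
        by_cases hneg : S n t' < 0
        · exact (inv_le_inv_of_neg (hsign.2 hneg) hneg).2 (by linarith)
        · exact inv_anti₀ (lt_of_le_of_ne (not_lt.1 hneg)
            (ht'.2 n n.lt_succ_self).symm) (by linarith)
      rw [hS, hS]
      linarith [hV' (n + 1) t t' htt' hl_eq]

/-- On one fibre `f` falls at rate at least `k`, so it stays in `(-ε, ε)` on a set of diameter at
most `2ε/k`; there are at most `B` fibres. -/
theorem volume_abs_lt_le_of_label {G : Set ℝ} {f : ℝ → ℝ} {κ : ℝ → ℤ} {a W : ℤ} {k ε B : ℝ}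
    (hk : 0 < k) (hκ : ∀ t ∈ G, κ t ∈ Finset.Icc a (a + W))
    (hf : ∀ t ∈ G, ∀ t' ∈ G, t ≤ t' → κ t = κ t' → k * (t' - t) ≤ f t - f t')
    (hB : 0 ≤ B) (hWB : (W : ℝ) + 1 ≤ B) :
    volume {t ∈ G | |f t| < ε} ≤ ENNReal.ofReal (B * (2 * ε / k)) := by
  have hcover : {t ∈ G | |f t| < ε} ⊆
      ⋃ i ∈ Finset.Icc a (a + W), {t ∈ G | |f t| < ε ∧ κ t = i} := by
    intro t ht
    exact Set.mem_biUnion (hκ t ht.1) ⟨ht.1, ht.2, rfl⟩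
  have hone : ∀ i, volume {t ∈ G | |f t| < ε ∧ κ t = i} ≤ ENNReal.ofReal (2 * ε / k) := by
    intro i
    have key : ∀ t ∈ {t ∈ G | |f t| < ε ∧ κ t = i}, ∀ t' ∈ {t ∈ G | |f t| < ε ∧ κ t = i},
        t ≤ t' → dist t t' ≤ 2 * ε / k := by
      intro t ht t' ht' htt'
      have h1 := hf t ht.1 t' ht'.1 htt' (ht.2.2.trans ht'.2.2.symm)
      have h2 := abs_lt.1 ht.2.1
      have h3 := abs_lt.1 ht'.2.1
      rw [dist_comm, Real.dist_eq, abs_of_nonneg (sub_nonneg.2 htt'), le_div_iff₀ hk]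
      linarith
    refine (Real.volume_le_diam _).trans (Metric.ediam_le fun t ht t' ht' => ?_)
    rw [edist_dist]
    refine ENNReal.ofReal_le_ofReal ?_
    rcases le_total t t' with h | h
    · exact key t ht t' ht' h
    · rw [dist_comm]; exact key t' ht' t ht h
  calc volume {t ∈ G | |f t| < ε}
      ≤ ∑ i ∈ Finset.Icc a (a + W), volume {t ∈ G | |f t| < ε ∧ κ t = i} :=
        (measure_mono hcover).trans (measure_biUnion_finset_le _ _)
    _ ≤ ∑ _i ∈ Finset.Icc a (a + W), ENNReal.ofReal (2 * ε / k) :=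
        Finset.sum_le_sum fun i _ => hone i
    _ = ((a + W + 1 - a).toNat : ENNReal) * ENNReal.ofReal (2 * ε / k) := by
        rw [Finset.sum_const, Int.card_Icc, nsmul_eq_mul]
    _ ≤ ENNReal.ofReal B * ENNReal.ofReal (2 * ε / k) := by
        gcongr
        rw [← ENNReal.ofReal_natCast]
        refine ENNReal.ofReal_le_ofReal ?_
        have : ((a + W + 1 - a).toNat : ℤ) = max (W + 1) 0 := by omega
        have h2 : ((a + W + 1 - a).toNat : ℝ) = max ((W : ℝ) + 1) 0 := by
          rw [← Int.cast_natCast, this]; push_cast; rfl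
        rw [h2]
        exact max_le hWB hB
    _ = ENNReal.ofReal (B * (2 * ε / k)) := (ENNReal.ofReal_mul hB).symm

theorem volume_abs_lt_le_of_recursion {c lam E : ℝ} (hc : 0 < c) (hlam : 0 < lam)
    {V S : ℕ → ℝ → ℝ} {l : ℕ → ℝ → ℤ} (hl : ∀ n, Monotone (l n))
    (hw : ∀ n, (l n 1 : ℝ) - l n 0 ≤ catEigenvalue ^ (n + 1) + 2)
    (hV : ∀ n t t', t ≤ t' → l n t = l n t' →
      c * catEigenvalue ^ n * (t' - t) ≤ V n t' - V n t)
    (hS0 : ∀ t, S 0 t = E - lam * V 0 t)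
    (hS : ∀ n t, S (n + 1) t = E - lam * V (n + 1) t - (S n t)⁻¹) (n : ℕ) {ε : ℝ} (hε : 0 < ε) :
    volume {t ∈ Set.Icc (0 : ℝ) 1 | |S n t| < ε} ≤ ENNReal.ofReal (42 / c * (ε / lam)) := by
  induction n using Nat.strong_induction_on generalizing ε with
  | _ n ih =>
    obtain ⟨κ, a, W, hW, -, hmem, hrate⟩ := exists_monotone_label hc hlam hl hw hV hS0 hS n
    have hpow := one_le_catEigenvalue_pow n
    -- At most `20μⁿ + 1 ≤ 21μⁿ` labels, each costing `2ε/(λcμⁿ)`: this is the source of 42.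
    have hmain := volume_abs_lt_le_of_label
      (mul_pos (mul_pos hlam hc) (pow_pos catEigenvalue_pos n)) (ε := ε) hmem hrate
      (B := 21 * catEigenvalue ^ n) (by linarith) (by linarith)
    -- The label ignores zeros of earlier ratios; these are null by the bound for `j < n` as `δ →
    -- 0`.
    have hzero : ∀ j < n, volume {t ∈ Set.Icc (0 : ℝ) 1 | S j t = 0} = 0 := by
      intro j hj
      have hle : ∀ δ : ℝ, 0 < δ → volume {t ∈ Set.Icc (0 : ℝ) 1 | S j t = 0} ≤
          ENNReal.ofReal (42 / c * (δ / lam)) := fun δ hδ =>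
        (measure_mono fun t (ht : t ∈ Set.Icc (0 : ℝ) 1 ∧ S j t = 0) =>
          show t ∈ Set.Icc (0 : ℝ) 1 ∧ |S j t| < δ from
            ⟨ht.1, by rwa [ht.2, abs_zero]⟩).trans (ih j hj hδ)
      have hlim : Tendsto (fun δ : ℝ => ENNReal.ofReal (42 / c * (δ / lam))) (𝓝[>] 0) (𝓝 0) := by
        have : Continuous fun δ : ℝ => ENNReal.ofReal (42 / c * (δ / lam)) :=
          ENNReal.continuous_ofReal.comp (by fun_prop)
        simpa using (this.tendsto 0).mono_left nhdsWithin_le_nhds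
      exact nonpos_iff_eq_zero.1 (ge_of_tendsto hlim (eventually_mem_nhdsWithin.mono hle))
    have hcover : {t ∈ Set.Icc (0 : ℝ) 1 | |S n t| < ε} ⊆
        {t ∈ {t ∈ Set.Icc (0 : ℝ) 1 | ∀ j < n, S j t ≠ 0} | |S n t| < ε} ∪
          ⋃ j ∈ Finset.range n, {t ∈ Set.Icc (0 : ℝ) 1 | S j t = 0} := by
      intro t ht
      by_cases h : ∀ j < n, S j t ≠ 0
      · exact Or.inl ⟨⟨ht.1, h⟩, ht.2⟩
      · push Not at h
        obtain ⟨j, hj, hj0⟩ := h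
        exact Or.inr (Set.mem_biUnion (Finset.mem_coe.2 (Finset.mem_range.2 hj)) ⟨ht.1, hj0⟩)
    have hnull : volume (⋃ j ∈ Finset.range n, {t ∈ Set.Icc (0 : ℝ) 1 | S j t = 0}) = 0 :=
      (measure_biUnion_null_iff (Finset.range n).countable_toSet).2
        fun j hj => hzero j (Finset.mem_range.1 hj)
    refine (measure_mono hcover).trans ((measure_union_le _ _).trans ?_)
    rw [hnull, add_zero]
    refine hmain.trans_eq (congrArg _ ?_)
    have := (pow_pos catEigenvalue_pos n).ne'
    field_simp
    norm_num

/-! ### Riccati ratios and their sublevel sets on the torus. -/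

/-- The ratio `pₙ₊₁ / pₙ` of successive upper left entries of the transfer matrices, given by the
Riccati recursion. -/
noncomputable def riccatiRatio (v : Torus2 → ℝ) (lam E : ℝ) : ℕ → Torus2 → ℝ
  | 0, ω => E - lam * v ω
  | n + 1, ω => E - lam * v (catMap^[n + 1] ω) - (riccatiRatio v lam E n ω)⁻¹

theorem measurable_riccatiRatio {v : Torus2 → ℝ} (hv : Measurable v) (lam E : ℝ) (n : ℕ) :
    Measurable (riccatiRatio v lam E n) := by
  have hT : ∀ n, Measurable fun ω => E - lam * v (catMap^[n] ω) := fun n =>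
    measurable_const.sub (measurable_const.mul
      (hv.comp (measurePreserving_catMap.measurable.iterate n)))
  induction n with
  | zero => exact hT 0
  | succ n ih => exact (hT (n + 1)).sub ih.inv

theorem transferMatrix_succ_zero_zero {v : Torus2 → ℝ} {lam E : ℝ} {ω : Torus2} (n : ℕ)
    (h : ∀ j < n, riccatiRatio v lam E j ω ≠ 0) :
    transferMatrix v lam E (n + 1) ω 0 0 =
      riccatiRatio v lam E n ω * transferMatrix v lam E n ω 0 0 := by
  have h00 : ∀ k, transferMatrix v lam E (k + 1) ω 0 0 =
      (E - lam * v (catMap^[k] ω)) * transferMatrix v lam E k ω 0 0 -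
        transferMatrix v lam E k ω 1 0 := fun k => by
    rw [transferMatrix, Matrix.mul_apply, Fin.sum_univ_two]
    simp [schrodingerMatrix]
    ring
  have h10 : ∀ k, transferMatrix v lam E (k + 1) ω 1 0 = transferMatrix v lam E k ω 0 0 :=
    fun k => by
      rw [transferMatrix, Matrix.mul_apply, Fin.sum_univ_two]
      simp [schrodingerMatrix]
  induction n with
  | zero => rw [h00]; simp [transferMatrix, riccatiRatio]
  | succ n ih =>
    have hn := h n n.lt_succ_self
    have := ih fun j hj => h j (hj.trans n.lt_succ_self)
    rw [h00 (n + 1), h10, riccatiRatio, this]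
    field_simp

theorem sum_log_riccatiRatio_le {v : Torus2 → ℝ} {lam E : ℝ} {ω : Torus2} (n : ℕ)
    (h : ∀ j, riccatiRatio v lam E j ω ≠ 0) :
    ∑ j ∈ Finset.range n, Real.log |riccatiRatio v lam E j ω| ≤ logNormTransfer v lam E n ω := by
  have key : transferMatrix v lam E n ω 0 0 ≠ 0 ∧ Real.log |transferMatrix v lam E n ω 0 0| =
      ∑ j ∈ Finset.range n, Real.log |riccatiRatio v lam E j ω| := by
    induction n with
    | zero => simp [transferMatrix]
    | succ n ih =>
      have hs := transferMatrix_succ_zero_zero n fun j _ => h j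
      refine ⟨hs ▸ mul_ne_zero (h n) ih.1, ?_⟩
      rw [hs, abs_mul, Real.log_mul (abs_ne_zero.2 (h n)) (abs_ne_zero.2 ih.1), ih.2,
        Finset.sum_range_succ, add_comm]
  rw [← key.2]
  exact Real.log_le_log (abs_pos.2 key.1) (abs_entry_le_opNorm _)

theorem measurable_toTorus2 : Measurable toTorus2 :=
  (AddCircle.measurable_mk'.comp measurable_fst).prodMk
    (AddCircle.measurable_mk'.comp measurable_snd)

theorem toTorus2_surjective : Function.Surjective toTorus2 := by
  rintro ⟨x, y⟩
  obtain ⟨a, rfl⟩ := QuotientAddGroup.mk_surjective x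
  obtain ⟨b, rfl⟩ := QuotientAddGroup.mk_surjective y
  exact ⟨(a, b), rfl⟩

theorem floor_add_sub_floor_le (x y : ℝ) : ((⌊x + y⌋ : ℤ) : ℝ) - ⌊x⌋ ≤ y + 1 := by
  linarith [Int.floor_le (x + y), Int.lt_floor_add_one x]

section SublevelSets

variable {v : Torus2 → ℝ} {c lam : ℝ}

theorem volume_line_abs_riccatiRatio_lt_le (hc : 0 < c)
    (hC1 : DifferentiableOn ℝ (fun p : ℝ × ℝ => v (toTorus2 p)) unitSquare)
    (hmono : ∀ p ∈ unitSquare,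
      c < fderivWithin ℝ (fun q : ℝ × ℝ => v (toTorus2 q)) unitSquare p unstableVec)
    (hlam : 0 < lam) (E : ℝ) (n : ℕ) {ε : ℝ} (hε : 0 < ε) (ω : Torus2) :
    volume {t ∈ Set.Icc (0 : ℝ) 1 |
      |riccatiRatio v lam E n (ω + toTorus2 (t • unstableVec))| < ε} ≤
        ENNReal.ofReal (42 / c * (ε / lam)) := by
  obtain ⟨p, rfl⟩ := toTorus2_surjective ω
  choose q hq using fun n => exists_iterate_catMap_line n p
  have hpos := fun n => pow_pos catEigenvalue_pos n
  have hu : 0 < unstableVec.1 := by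
    rw [unstableVec_fst]; linarith [lt_catEigenvalue]
  have hm1 : ∀ n, Monotone fun t : ℝ =>
      ⌊(q n + (catEigenvalue ^ n * t) • unstableVec).1⌋ := by
    intro n t t' htt'
    refine Int.floor_mono ?_
    simp only [Prod.fst_add, Prod.smul_fst, smul_eq_mul]
    have := hpos n
    gcongr
  have hm2 : ∀ n, Monotone fun t : ℝ =>
      ⌊(q n + (catEigenvalue ^ n * t) • unstableVec).2⌋ := by
    intro n t t' htt'
    refine Int.floor_mono ?_
    simp only [Prod.snd_add, Prod.smul_snd, smul_eq_mul, unstableVec_snd, mul_one]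
    have := hpos n
    gcongr
  refine volume_abs_lt_le_of_recursion hc hlam
    (V := fun n t => v (toTorus2 (q n + (catEigenvalue ^ n * t) • unstableVec)))
    (S := fun n t => riccatiRatio v lam E n (toTorus2 (p + t • unstableVec)))
    -- Both floors are monotone in `t`, so equality of their sums forces equality of each: the image
    -- stays in one square.
    (l := fun n t => ⌊(q n + (catEigenvalue ^ n * t) • unstableVec).1⌋ +
      ⌊(q n + (catEigenvalue ^ n * t) • unstableVec).2⌋) (E := E)
    (fun n => (hm1 n).add (hm2 n)) (fun n => ?_) (fun n t t' htt' heq => ?_) (fun t => ?_)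
    (fun n t => ?_) n hε
  · have h1 := floor_add_sub_floor_le (q n).1 (catEigenvalue ^ n * unstableVec.1)
    have h2 := floor_add_sub_floor_le (q n).2 (catEigenvalue ^ n)
    rw [unstableVec_fst] at h1
    simp only [mul_one, mul_zero, zero_smul, add_zero, Prod.fst_add, Prod.snd_add, Prod.smul_fst,
      Prod.smul_snd, smul_eq_mul, unstableVec_fst, unstableVec_snd, Int.cast_add, pow_succ]
    linarith
  · have h1 := hm1 n htt'
    have h2 := hm2 n htt'
    dsimp only at h1 h2 heq ⊢
    have hadd : q n + (catEigenvalue ^ n * t') • unstableVec =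
        q n + (catEigenvalue ^ n * t) • unstableVec +
          (catEigenvalue ^ n * (t' - t)) • unstableVec := by
      rw [add_assoc, ← add_smul]; congr 2; ring
    rw [hadd] at h1 h2 heq ⊢
    rw [mul_assoc]
    exact mul_le_sub_of_floor_eq hC1 hmono (mul_nonneg (hpos n).le (sub_nonneg.2 htt'))
      (by omega) (by omega)
  · simp only [← hq]; rfl
  · simp only [← hq]; rfl

/-- By translation invariance, `volume s` is the average over `ω` of the time that the segment from
`ω` spends in `s`. -/
theorem measure_le_of_forall_line {s : Set Torus2} (hs : MeasurableSet s) {B : ENNReal}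
    (h : ∀ ω, volume {t ∈ Set.Icc (0 : ℝ) 1 | ω + toTorus2 (t • unstableVec) ∈ s} ≤ B) :
    volume s ≤ B := by
  have hmeas : Measurable fun x : Torus2 × ℝ => x.1 + toTorus2 (x.2 • unstableVec) :=
    measurable_fst.add (measurable_toTorus2.comp (measurable_snd.smul_const _))
  have hline : Measurable fun t : ℝ => toTorus2 (t • unstableVec) :=
    measurable_toTorus2.comp (measurable_id.smul_const _)
  calc volume s = ∫⁻ _t in Set.Icc (0 : ℝ) 1, volume s := by simp
    _ = ∫⁻ t in Set.Icc (0 : ℝ) 1, ∫⁻ ω : Torus2,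
          s.indicator 1 (ω + toTorus2 (t • unstableVec)) := by
        refine lintegral_congr fun t => ?_
        rw [lintegral_add_right_eq_self (fun ω => s.indicator (1 : Torus2 → ENNReal) ω),
          lintegral_indicator_one hs]
    _ = ∫⁻ ω : Torus2, ∫⁻ t in Set.Icc (0 : ℝ) 1,
          s.indicator 1 (ω + toTorus2 (t • unstableVec)) := by
        symm
        exact lintegral_lintegral_swap
          ((measurable_one.indicator hs).comp hmeas).aemeasurable
    _ ≤ ∫⁻ _ω : Torus2, B := by
        refine lintegral_mono fun ω => ?_
        have hpre : MeasurableSet ((fun t : ℝ => ω + toTorus2 (t • unstableVec)) ⁻¹' s) :=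
          (hline.const_add ω) hs
        refine le_trans (le_of_eq ?_) (h ω)
        calc ∫⁻ t in Set.Icc (0 : ℝ) 1, s.indicator 1 (ω + toTorus2 (t • unstableVec))
            = ∫⁻ t in Set.Icc (0 : ℝ) 1,
                ((fun t : ℝ => ω + toTorus2 (t • unstableVec)) ⁻¹' s).indicator 1 t := rfl
          _ = _ := by
            rw [lintegral_indicator_one hpre, Measure.restrict_apply hpre, Set.inter_comm]
            rfl
    _ = B := by simp

theorem volume_abs_riccatiRatio_lt_le (hv : Measurable v) (hc : 0 < c)
    (hC1 : DifferentiableOn ℝ (fun p : ℝ × ℝ => v (toTorus2 p)) unitSquare)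
    (hmono : ∀ p ∈ unitSquare,
      c < fderivWithin ℝ (fun q : ℝ × ℝ => v (toTorus2 q)) unitSquare p unstableVec)
    (hlam : 0 < lam) (E : ℝ) (n : ℕ) {ε : ℝ} (hε : 0 < ε) :
    volume {ω | |riccatiRatio v lam E n ω| < ε} ≤ ENNReal.ofReal (42 / c * (ε / lam)) :=
  measure_le_of_forall_line
    (measurableSet_lt (measurable_riccatiRatio hv lam E n).abs measurable_const)
    (volume_line_abs_riccatiRatio_lt_le hc hC1 hmono hlam E n hε)

end SublevelSets

/-! ### From sublevel bounds to the integral of the logarithm. -/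

section LogIntegral

variable {α : Type*} [MeasurableSpace α] {m : Measure α} {f : α → ℝ} {C lam : ℝ}

theorem ae_ne_zero_of_measure_abs_lt_le
    (h : ∀ ε > 0, m {x | |f x| < ε} ≤ ENNReal.ofReal (C * (ε / lam))) : ∀ᵐ x ∂m, f x ≠ 0 := by
  have hlim : Tendsto (fun δ : ℝ => ENNReal.ofReal (C * (δ / lam))) (𝓝[>] 0) (𝓝 0) := by
    have : Continuous fun δ : ℝ => ENNReal.ofReal (C * (δ / lam)) :=
      ENNReal.continuous_ofReal.comp (by fun_prop)
    simpa using (this.tendsto 0).mono_left nhdsWithin_le_nhds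
  rw [ae_iff]
  refine nonpos_iff_eq_zero.1 (ge_of_tendsto hlim (eventually_mem_nhdsWithin.mono fun δ hδ =>
    (measure_mono fun x hx => ?_).trans (h δ hδ)))
  have hx0 : f x = 0 := not_not.1 hx
  show |f x| < δ
  rw [hx0, abs_zero]
  exact hδ

/-- Layer cake with `ε = λe^{-τ}`: the tail at `τ` is at most `Ce^{-τ}`, whose integral over `τ > 0`
is `C`. -/
theorem lintegral_neg_log_le (hf : Measurable f) (hlam : 0 < lam)
    (h : ∀ ε > 0, m {x | |f x| < ε} ≤ ENNReal.ofReal (C * (ε / lam))) (hC : 0 ≤ C) :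
    ∫⁻ x, ENNReal.ofReal (max 0 (-Real.log (|f x| / lam))) ∂m ≤ ENNReal.ofReal C := by
  have hmeas : Measurable fun x => max 0 (-Real.log (|f x| / lam)) :=
    measurable_const.max (Real.measurable_log.comp (hf.abs.div_const lam)).neg
  rw [lintegral_eq_lintegral_meas_lt m (ae_of_all _ fun x => le_max_left (0 : ℝ) _)
    hmeas.aemeasurable]
  have hle : ∀ τ ∈ Set.Ioi (0 : ℝ), m {x | τ < max 0 (-Real.log (|f x| / lam))} ≤
      ENNReal.ofReal (C * Real.exp (-τ)) := by
    intro τ hτ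
    have := h (lam * Real.exp (-τ)) (mul_pos hlam (Real.exp_pos _))
    rw [mul_div_cancel_left₀ _ hlam.ne'] at this
    refine (measure_mono fun x hx => ?_).trans this
    have hx1 : τ < -Real.log (|f x| / lam) :=
      (lt_max_iff.1 hx).resolve_left (not_lt.2 (le_of_lt hτ))
    -- As `Real.log 0 = 0`, a zero of `f` does not lie in the set where the integrand exceeds `τ >
    -- 0`.
    have hne : f x ≠ 0 := by
      intro h0
      rw [h0] at hx1
      simp only [abs_zero, zero_div, Real.log_zero, neg_zero] at hx1
      exact lt_asymm hx1 hτ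
    have hpos : 0 < |f x| / lam := div_pos (abs_pos.2 hne) hlam
    have h2 : |f x| / lam < Real.exp (-τ) :=
      (Real.log_lt_iff_lt_exp hpos).1 (by linarith)
    show |f x| < lam * Real.exp (-τ)
    rwa [div_lt_iff₀' hlam] at h2
  refine (setLIntegral_mono' measurableSet_Ioi hle).trans ?_
  rw [← ofReal_integral_eq_lintegral_ofReal, integral_const_mul, integral_exp_neg_Ioi_zero,
    mul_one]
  · exact (integrableOn_exp_neg_Ioi 0).const_mul C
  · exact ae_of_all _ fun τ => mul_nonneg hC (Real.exp_pos _).le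

end LogIntegral

/-! ### Lower bound for the Lyapunov exponent. -/

theorem le_integral_logNormTransfer {v : Torus2 → ℝ} {c lam : ℝ} (hv : Measurable v)
    (hbdd : ∃ M : ℝ, ∀ ω : Torus2, |v ω| ≤ M) (hc : 0 < c)
    (hC1 : DifferentiableOn ℝ (fun p : ℝ × ℝ => v (toTorus2 p)) unitSquare)
    (hmono : ∀ p ∈ unitSquare,
      c < fderivWithin ℝ (fun q : ℝ × ℝ => v (toTorus2 q)) unitSquare p unstableVec)
    (hlam : 0 < lam) (E : ℝ) (n : ℕ) :
    n * (Real.log lam - 42 / c) ≤ ∫ ω, logNormTransfer v lam E n ω := by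
  have hC : 0 ≤ 42 / c := by positivity
  have hsub : ∀ j, ∀ ε > 0, volume {ω | |riccatiRatio v lam E j ω| < ε} ≤
      ENNReal.ofReal (42 / c * (ε / lam)) := fun j ε hε =>
    volume_abs_riccatiRatio_lt_le hv hc hC1 hmono hlam E j hε
  let h : ℕ → Torus2 → ℝ := fun j ω => max 0 (-Real.log (|riccatiRatio v lam E j ω| / lam))
  have hnonneg : ∀ j ω, 0 ≤ h j ω := fun j ω => le_max_left _ _
  have hlint : ∀ j, ∫⁻ ω, ENNReal.ofReal (h j ω) ≤ ENNReal.ofReal (42 / c) := fun j =>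
    lintegral_neg_log_le (measurable_riccatiRatio hv lam E j) hlam (hsub j) hC
  have hmeas : ∀ j, Measurable (h j) := fun j => measurable_const.max
    (Real.measurable_log.comp ((measurable_riccatiRatio hv lam E j).abs.div_const lam)).neg
  have hint : ∀ j, Integrable (h j) := fun j =>
    (lintegral_ofReal_ne_top_iff_integrable (hmeas j).aestronglyMeasurable
      (ae_of_all _ (hnonneg j))).1 ((hlint j).trans_lt ENNReal.ofReal_lt_top).ne
  have hle : ∀ j, ∫ ω, h j ω ≤ 42 / c := fun j => by
    rw [integral_eq_lintegral_of_nonneg_ae (ae_of_all _ (hnonneg j))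
      (hmeas j).aestronglyMeasurable]
    exact ENNReal.toReal_le_of_le_ofReal hC (hlint j)
  have hsum : Integrable fun ω => ∑ j ∈ Finset.range n, (Real.log lam - h j ω) :=
    integrable_finsetSum _ fun j _ => (integrable_const _).sub (hint j)
  calc n * (Real.log lam - 42 / c)
      = ∑ _j ∈ Finset.range n, (Real.log lam - 42 / c) := by
        rw [Finset.sum_const, Finset.card_range, nsmul_eq_mul]
    _ ≤ ∑ j ∈ Finset.range n, ∫ ω, (Real.log lam - h j ω) := by
        refine Finset.sum_le_sum fun j _ => ?_
        rw [integral_sub (integrable_const _) (hint j)]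
        rw [integral_const, probReal_univ, one_smul]
        exact sub_le_sub_left (hle j) _
    _ = ∫ ω, ∑ j ∈ Finset.range n, (Real.log lam - h j ω) :=
        (integral_finsetSum _ fun j _ => (integrable_const _).sub (hint j)).symm
    _ ≤ ∫ ω, logNormTransfer v lam E n ω := by
        refine integral_mono_ae hsum (integrable_logNormTransfer v hv hbdd lam E n) ?_
        filter_upwards [ae_all_iff.2 fun j => ae_ne_zero_of_measure_abs_lt_le (hsub j)] with ω hω
        refine (Finset.sum_le_sum fun j _ => ?_).trans (sum_log_riccatiRatio_le n hω)
        have h1 : -Real.log (|riccatiRatio v lam E j ω| / lam) ≤ h j ω := le_max_right _ _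
        rw [Real.log_div (abs_ne_zero.2 (hω j)) hlam.ne'] at h1
        linarith

theorem log_sub_le_lyapunovExponent {v : Torus2 → ℝ} {c lam : ℝ} (hv : Measurable v)
    (hbdd : ∃ M : ℝ, ∀ ω : Torus2, |v ω| ≤ M) (hc : 0 < c)
    (hC1 : DifferentiableOn ℝ (fun p : ℝ × ℝ => v (toTorus2 p)) unitSquare)
    (hmono : ∀ p ∈ unitSquare,
      c < fderivWithin ℝ (fun q : ℝ × ℝ => v (toTorus2 q)) unitSquare p unstableVec)
    (hlam : 0 < lam) (E : ℝ) :
    Real.log lam - 42 / c ≤ lyapunovExponent v E lam := by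
  refine ge_of_tendsto (tendsto_meanLogNorm v hv hbdd lam E) ?_
  filter_upwards [eventually_gt_atTop 0] with n hn
  have hn' : (0 : ℝ) < n := Nat.cast_pos.2 hn
  rw [meanLogNorm, one_div, ← div_eq_inv_mul, le_div_iff₀' hn']
  exact le_integral_logNormTransfer hv hbdd hc hC1 hmono hlam E n

theorem theorem2p4 (v : Torus2 → ℝ) (hmeas : Measurable v)
    (hbdd : ∃ M : ℝ, ∀ ω : Torus2, |v ω| ≤ M)
    (hC1 : ContDiffOn ℝ 1 (fun p : ℝ × ℝ => v (toTorus2 p)) unitSquare)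
    (hmono : ∃ c : ℝ, 0 < c ∧ ∀ p ∈ unitSquare,
      c < fderivWithin ℝ (fun q : ℝ × ℝ => v (toTorus2 q)) unitSquare p unstableVec) :
    -- the integrals and the limit that define the Lyapunov exponent exist
    (∀ lam E : ℝ, (∀ n : ℕ, Integrable (logNormTransfer v lam E n)) ∧
      Tendsto (meanLogNorm v lam E) atTop (𝓝 (lyapunovExponent v E lam))) ∧
    -- the lower bound, with a constant that depends on the potential only
    (∃ C₀ : ℝ, 0 < C₀ ∧ ∀ lam : ℝ, 0 < lam → ∀ E : ℝ,
      Real.log lam - C₀ < lyapunovExponent v E lam) ∧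
    -- uniform positivity for large coupling
    (∃ lam₀ : ℝ, 0 < lam₀ ∧ ∀ lam : ℝ, lam₀ ≤ lam → ∃ δ : ℝ, 0 < δ ∧ ∀ E : ℝ,
      δ ≤ lyapunovExponent v E lam) := by
  obtain ⟨c, hc, hmono⟩ := hmono
  have hbound := fun (lam : ℝ) (hlam : 0 < lam) (E : ℝ) =>
    log_sub_le_lyapunovExponent hmeas hbdd hc (hC1.differentiableOn one_ne_zero) hmono hlam E
  refine ⟨fun lam E => ⟨integrable_logNormTransfer v hmeas hbdd lam E,
    tendsto_meanLogNorm v hmeas hbdd lam E⟩,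
    -- The extra 1 makes the inequality strict; in `λ₀` below it yields the lower bound `δ = 1`.
    ⟨42 / c + 1, by positivity, fun lam hlam E => by linarith [hbound lam hlam E]⟩,
    ⟨Real.exp (42 / c + 1), Real.exp_pos _, fun lam hlam => ⟨1, one_pos, fun E => ?_⟩⟩⟩
  have hpos := (Real.exp_pos _).trans_le hlam
  linarith [hbound lam hpos E, (Real.le_log_iff_exp_le hpos).2 hlam]
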